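/- Let $d\ge 1$ and let $\Lambda\subset\mathbb{R}^d$ be a full-rank lattice of covolume $1$, with dual lattice $\Lambda^*=\{y\in\mathbb{R}^d : \langle y,x\rangle\in\mathbb{Z}\text{ for each }x\in\Lambda\}$, where $\langle\cdot,\cdot\rangle$ is the standard inner product. Let $\tau=(\tau_1,\dots,\tau_d)\in\mathbb{R}^d$ with $\tau_1+\dots+\tau_d=0$. For such a $\tau$ put $\mathcal{B}_\tau=\operatorname{diag}(e^{\tau_1},\dots,e^{\tau_d})\,\mathcal{B}$, where $\mathcal{B}=\{x\in\mathbb{R}^d : \max_i|x_i|\le 1\}$. For a lattice $M\subset\mathbb{R}^d$ and $1\le k\le d$ let $\lambda_k(\mathcal{B}_\tau,M)$ be the $k$-th successive minimum, that is, the infimum of the positive $\lambda$ such that $\lambda\mathcal{B}_\tau$ contains at least $k$ linearly independent vectors of $M$, and put $$L_k(\tau,M)=\log\lambda_k(\mathcal{B}_\tau,M),\qquad S_k(\tau,M)=\sum_{1\le j\le k}L_j(\tau,M).$$ Then: (i) $-\log d\le L_k(\tau,\Lambda)+L_{d+1-k}(-\tau,\Lambda^*)\le\log d!$ for every $k=1,\dots,d$;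 (ii) $-k\log d\le S_k(\tau,\Lambda)-S_{d-k}(-\tau,\Lambda^*)\le(k+1)\log d!$ for every $k=1,\dots,d-1$. -/

import Mathlib

noncomputable section

namespace MultParamGeom

/-- The standard inner product `⟨y, x⟩ = ∑ i, y i * x i` on `ℝ^d`, as a bilinear form. -/
def stdForm (d : ℕ) : LinearMap.BilinForm ℝ (Fin d → ℝ) :=
  dotProductBilin ℝ ℝ

/-- The dual lattice `Λ* = {y | ⟨y, x⟩ ∈ ℤ for each x ∈ Λ}`. -/
def dualLattice {d : ℕ} (Λ : Submodule ℤ (Fin d → ℝ)) : Submodule ℤ (Fin d → ℝ) :=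
  (stdForm d).dualSubmodule Λ

theorem mem_dualLattice {d : ℕ} (Λ : Submodule ℤ (Fin d → ℝ)) (y : Fin d → ℝ) :
    y ∈ dualLattice Λ ↔ ∀ x ∈ Λ, ∃ n : ℤ, ∑ i, y i * x i = (n : ℝ) := by
  simp only [dualLattice, LinearMap.BilinForm.mem_dualSubmodule, stdForm, Submodule.mem_one]
  refine forall₂_congr fun x _ => exists_congr fun n => ?_
  simp [dotProductBilin, dotProduct, eq_comm]

/-- The box `B_τ = D_τ B`, where `D_τ = diag (exp τ₁, …, exp τ_d)` and `B` is the closed unit ball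
of the sup-norm (which is the norm of the type `Fin d → ℝ`). -/
def box {d : ℕ} (τ : Fin d → ℝ) : Set (Fin d → ℝ) :=
  (Matrix.diagonal fun i => Real.exp (τ i)).mulVec '' Metric.closedBall 0 1

open scoped Pointwise in
/-- The `k`-th successive minimum of `B` with respect to `Λ`: the infimum of the positive `r` such
that `r B` contains at least `k` linearly independent vectors of `Λ`. -/
def succMin {d : ℕ} (B : Set (Fin d → ℝ)) (Λ : Submodule ℤ (Fin d → ℝ)) (k : ℕ) : ℝ :=
  sInf {r : ℝ | 0 < r ∧ ∃ v : Fin k → (Fin d → ℝ),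
    LinearIndependent ℝ v ∧ ∀ i, v i ∈ Λ ∧ v i ∈ r • B}

/-- `L_k(τ, Λ) = log λ_k(B_τ, Λ)`. -/
def L {d : ℕ} (k : ℕ) (τ : Fin d → ℝ) (Λ : Submodule ℤ (Fin d → ℝ)) : ℝ :=
  Real.log (succMin (box τ) Λ k)

/-- `S_k(τ, Λ) = ∑_{1 ≤ j ≤ k} L_j(τ, Λ)`. -/
def S {d : ℕ} (k : ℕ) (τ : Fin d → ℝ) (Λ : Submodule ℤ (Fin d → ℝ)) : ℝ :=
  ∑ j ∈ Finset.Icc 1 k, L j τ Λ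

end MultParamGeom

end

/-!
For `D = diag (exp τ₁, …, exp τ_d)` one has `λ_k (B_τ, Λ) = λ_k (B, D⁻¹ Λ)`, and the dual of `D⁻¹ Λ`
is `D Λ*`, so it suffices to treat `τ = 0`, that is, the sup norm, for lattices of any covolume.

Let `v` and `w` be systems of linearly independent vectors realising the successive minima of `Λ`
and `Λ*`. For dimension reasons the span of `v₁, …, v_k` is not orthogonal to that of
`w₁, …, w_{d+1-k}`; hence some pairing `⟨v_i, w_j⟩` is a nonzero integer, and `1 ≤ d ‖v_i‖ ‖w_j‖`
is the lower bound in (i). For the upper bound, the cofactor vectors of the matrix with rows `v`,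
divided by the covolume, are linearly independent vectors of `Λ*`. The `j`-th one has norm at most
`d! ∏_{i ≠ j} ‖v_i‖ / covol Λ`, which Minkowski's second theorem `∏ ‖v_i‖ ≤ covol Λ` turns into
`d! / ‖v_j‖ ≤ d! / ‖v_k‖` for the `d + 1 - k` indices `j ≥ k`. Part (ii) is the sum of (i) over the
first `k` indices, combined with `covol Λ* / d! ≤ ∏ ‖w_i‖ ≤ covol Λ*`.

Minkowski's second theorem itself follows by stretching the ball of radius `1 / 2` by the factors
`‖v_i‖` in the basis `v`, in such a way that distinct points of the image are never congruent modulo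
`Λ`; by Blichfeldt's theorem the volume of the image is then at most the covolume.
-/

namespace MultParamGeom

open Module MeasureTheory

section Minkowski

section DiagonalMaps

variable {ι R M : Type*} [Fintype ι] [DecidableEq ι] [CommRing R] [AddCommGroup M] [Module R M]

/-- The linear endomorphism that multiplies the `i`-th coordinate in the basis `B` by `a i`. -/
noncomputable def diagonalMap (B : Basis ι R M) (a : ι → R) : M →ₗ[R] M :=
  Matrix.toLin B B (Matrix.diagonal a)

theorem repr_diagonalMap (B : Basis ι R M) (a : ι → R) (x : M) (i : ι) :
    B.repr (diagonalMap B a x) i = a i * B.repr x i := by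
  rw [diagonalMap, Matrix.repr_toLin, Matrix.mulVec_diagonal]

theorem det_diagonalMap (B : Basis ι R M) (a : ι → R) :
    LinearMap.det (diagonalMap B a) = ∏ i, a i := by
  rw [diagonalMap, LinearMap.det_toLin, Matrix.det_diagonal]

variable [Preorder ι] [DecidableLE ι]

/-- The projection that kills the coordinates in the basis `B` whose index is not `≥ i`; its
fibres are the translates of the span of the remaining basis vectors. -/
noncomputable def tailProj (B : Basis ι R M) (i : ι) : M →ₗ[R] M :=
  diagonalMap B fun j => if i ≤ j then 1 else 0

theorem repr_tailProj (B : Basis ι R M) (i j : ι) (x : M) :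
    B.repr (tailProj B i x) j = if i ≤ j then B.repr x j else 0 := by
  rw [tailProj, repr_diagonalMap, ite_mul, one_mul, zero_mul]

theorem tailProj_congr (B : Basis ι R M) {i : ι} {x y : M}
    (h : ∀ j ≥ i, B.repr x j = B.repr y j) : tailProj B i x = tailProj B i y := by
  refine B.ext_elem fun j => ?_
  rw [repr_tailProj, repr_tailProj]
  split_ifs with hij
  exacts [h j hij, rfl]

theorem diagonalMap_eq_sum_smul_tailProj [LocallyFiniteOrderBot ι] (B : Basis ι R M) {l δ : ι → R}
    (hl : ∀ k, l k = ∑ i ∈ Finset.Iic k, δ i) (x : M) :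
    diagonalMap B l x = ∑ i, δ i • tailProj B i x := by
  refine B.ext_elem fun k => ?_
  simp [repr_diagonalMap, repr_tailProj, hl, Finset.sum_mul, ← Finset.sum_filter,
    Finset.filter_ge_eq_Iic]

end DiagonalMaps

theorem exists_nonneg_eq_sum_Iic {n : ℕ} {l : Fin n → ℝ} (hl : Monotone l) (h0 : ∀ i, 0 ≤ l i) :
    ∃ δ : Fin n → ℝ, (∀ i, 0 ≤ δ i) ∧ ∀ k, l k = ∑ i ∈ Finset.Iic k, δ i := by
  simp only [← Finset.filter_ge_eq_Iic, Finset.sum_filter]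
  induction n with
  | zero => exact ⟨l, h0, fun k => k.elim0⟩
  | succ n ih =>
    obtain ⟨δ, hδ, hs⟩ := ih (l := fun i => l i.succ - l 0)
      (fun i j hij => sub_le_sub_right (hl (Fin.succ_le_succ_iff.2 hij)) _)
      (fun i => sub_nonneg.2 (hl (Fin.zero_le _)))
    refine ⟨Fin.cons (l 0) δ, Fin.cases (h0 0) (by simpa using hδ), Fin.cases ?_ fun k => ?_⟩
    · simp
    · simp [Fin.sum_univ_succ, ← hs]

theorem norm_sum_smul_lt {ι E : Type*} [SeminormedAddCommGroup E] [NormedSpace ℝ E]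
    {s : Finset ι} {δ : ι → ℝ} {r : ℝ} {w : ι → E} (hδ : ∀ i ∈ s, 0 ≤ δ i)
    (hpos : 0 < ∑ i ∈ s, δ i) (hw : ∀ i ∈ s, ‖w i‖ < r) :
    ‖∑ i ∈ s, δ i • w i‖ < (∑ i ∈ s, δ i) * r := by
  have h := (convex_ball (0 : E) r).centerMass_mem hδ hpos fun i hi =>
    mem_ball_zero_iff.2 (hw i hi)
  rwa [Finset.centerMass, mem_ball_zero_iff, norm_smul, norm_inv, Real.norm_of_nonneg hpos.le,
    inv_mul_lt_iff₀ hpos] at h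

theorem exists_measurable_translation {E : Type*} [Add E] [TopologicalSpace E]
    [SecondCountableTopology E] [ContinuousAdd E] [MeasurableSpace E] [OpensMeasurableSpace E]
    {K Q : Set E} (hK : K.Nonempty) (hQ : IsOpen Q) :
    ∃ (m : E → ℕ) (c : ℕ → E), Measurable m ∧ (∀ n, c n ∈ K) ∧
      ∀ y, (∃ z ∈ K, y + z ∈ Q) → y + c (m y) ∈ Q := by
  have := hK.to_subtype
  let c : ℕ → K := TopologicalSpace.denseSeq K
  let U : ℕ → Set E := fun n => {y | y + c n ∈ Q}
  have hU : ∀ n, MeasurableSet (U n) := fun n => (hQ.preimage (by fun_prop)).measurableSet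
  obtain ⟨m, hm, hmU⟩ := exists_measurable_piecewise (disjointed U)
    (fun n => MeasurableSet.disjointed hU n) (fun n _ => n) (fun n => measurable_const)
    fun i j hij x hx => ((disjoint_disjointed U hij).le_bot hx).elim
  refine ⟨m, fun n => c n, hm, fun n => (c n).2, ?_⟩
  rintro y ⟨z, hz, hyz⟩
  obtain ⟨n, hn⟩ := (TopologicalSpace.denseRange_denseSeq K).exists_mem_open
    (hQ.preimage (f := fun z : K => y + z) (by fun_prop)) ⟨⟨z, hz⟩, hyz⟩
  have hy : y ∈ ⋃ n, disjointed U n := iUnion_disjointed (f := U) ▸ Set.mem_iUnion.2 ⟨n, hn⟩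
  obtain ⟨i, hi⟩ := Set.mem_iUnion.1 hy
  rw [hmU i hi]
  exact disjointed_subset U i hi

variable {E : Type*} [NormedAddCommGroup E] [NormedSpace ℝ E] [FiniteDimensional ℝ E]
  [MeasurableSpace E] [BorelSpace E]

theorem measure_image_linearMap_add {ι : Type*} [Countable ι] [MeasurableSpace ι]
    [MeasurableSingletonClass ι] (μ : Measure E) [μ.IsAddHaarMeasure] (A : E →ₗ[ℝ] E) {m : E → ι}
    (hm : Measurable m) (c : ι → E) {Q : Set E} (hQ : MeasurableSet Q)
    (hinj : Set.InjOn (fun x => A x + c (m x)) Q) :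
    μ ((fun x => A x + c (m x)) '' Q) = ENNReal.ofReal |LinearMap.det A| * μ Q := by
  set F : E → E := fun x => A x + c (m x)
  set P : ι → Set E := fun t => Q ∩ m ⁻¹' {t}
  have hF : Measurable F :=
    A.continuous_of_finiteDimensional.measurable.add ((measurable_of_countable c).comp hm)
  have hP : ∀ t, MeasurableSet (P t) := fun t => hQ.inter (hm (measurableSet_singleton t))
  have hPQ : ⋃ t, P t = Q := by
    simp only [P, ← Set.inter_iUnion, ← Set.preimage_iUnion, Set.iUnion_of_singleton,
      Set.preimage_univ, Set.inter_univ]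
  have hdisj : Pairwise (Function.onFun Disjoint P) := fun s t hst =>
    Set.disjoint_left.2 fun x hxs hxt => hst (hxs.2.symm.trans hxt.2)
  have hpiece : ∀ t, μ (F '' P t) = ENNReal.ofReal |LinearMap.det A| * μ (P t) := by
    intro t
    have himage : F '' P t = (fun y => y + c t) '' (A '' P t) := by
      rw [Set.image_image]
      refine Set.image_congr fun x hx => ?_
      simp only [F, show m x = t from hx.2]
    rw [himage, Set.image_add_right, measure_preimage_add_right, Measure.addHaar_image_linearMap]
  have hdisjF : Pairwise (Function.onFun Disjoint fun t => F '' P t) := fun s t hst =>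
    (hdisj hst).image hinj Set.inter_subset_left Set.inter_subset_left
  calc μ (F '' Q) = ∑' t, μ (F '' P t) := by
        rw [← hPQ, Set.image_iUnion, measure_iUnion hdisjF fun t =>
          (hP t).image_of_measurable_injOn hF (hinj.mono Set.inter_subset_left)]
    _ = ENNReal.ofReal |LinearMap.det A| * μ Q := by
        simp only [hpiece, ENNReal.tsum_mul_left, ← measure_iUnion hdisj hP, hPQ]

theorem measure_le_covolume_of_forall_sub_mem (μ : Measure E) [μ.IsAddHaarMeasure]
    {Λ : Submodule ℤ E} [DiscreteTopology Λ] [IsZLattice ℝ Λ] {T : Set E}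
    (hT : NullMeasurableSet T μ) (h : ∀ x ∈ T, ∀ y ∈ T, x - y ∈ Λ → x = y) :
    μ T ≤ ENNReal.ofReal (ZLattice.covolume Λ μ) := by
  have : Countable Λ.toAddSubgroup := inferInstanceAs (Countable Λ)
  set b := Free.chooseBasis ℤ Λ
  have fund := ZLattice.isAddFundamentalDomain b μ
  rw [ZLattice.covolume_eq_measure_fundamentalDomain Λ μ fund, measureReal_def,
    ENNReal.ofReal_toReal (ZSpan.fundamentalDomain_isBounded _).measure_lt_top.ne]
  by_contra! hlt
  obtain ⟨u, v, huv, hnd⟩ := exists_pair_mem_lattice_not_disjoint_vadd (L := Λ.toAddSubgroup)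
    fund hT hlt
  obtain ⟨_, ⟨x, hx, rfl⟩, ⟨y, hy, hxy⟩⟩ := Set.not_disjoint_iff.1 hnd
  replace hxy : (v : E) + y = u + x := hxy
  have hsub : x - y = v - u := by rw [sub_eq_sub_iff_add_eq_add, add_comm, ← hxy, add_comm]
  obtain rfl : x = y := h x hx y hy (hsub ▸ sub_mem v.2 u.2)
  exact huv (Subtype.ext (add_right_cancel hxy).symm)

theorem exists_measurable_tailProj_section {n : ℕ} (B : Basis (Fin n) ℝ E) (i : Fin n) {Q : Set E}
    (hQ : IsOpen Q) :
    ∃ (m : E → ℕ) (c : ℕ → E), Measurable m ∧ (∀ t, ∀ j ≥ i, B.repr (c t) j = 0) ∧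
      ∀ x ∈ Q, tailProj B i x + c (m (tailProj B i x)) ∈ Q := by
  obtain ⟨m, c, hm, hc, hmQ⟩ := exists_measurable_translation
    (K := {z | ∀ j ≥ i, B.repr z j = 0}) ⟨0, fun j _ => by simp⟩ hQ
  refine ⟨m, c, hm, hc, fun x hx => hmQ _ ⟨x - tailProj B i x, fun j hij => ?_, by simpa⟩⟩
  simp [repr_tailProj, ge_iff_le.1 hij]

/-- Summation by parts writes the diagonal stretch as a nonnegative combination of tail projections.
A countably valued translation that depends only on the projected point carries each projection of
the ball back into the ball. For points which agree beyond the `k`-th coordinate, only the terms of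
index `≤ k` in this combination can differ. -/
theorem exists_stretch {n : ℕ} (B : Basis (Fin n) ℝ E) {l : Fin n → ℝ} (hl : Monotone l)
    (hl0 : ∀ i, 0 < l i) {r : ℝ} :
    ∃ (F : E → E) (m : E → Fin n → ℕ) (c : (Fin n → ℕ) → E),
      (∀ x, F x = diagonalMap B l x + c (m x)) ∧ Measurable m ∧
      ∀ x ∈ Metric.ball 0 r, ∀ y ∈ Metric.ball 0 r, ∀ k, (∀ j > k, B.repr x j = B.repr y j) →
        ‖F x - F y‖ < l k * (2 * r) ∧
          B.repr (F x - F y) k = l k * (B.repr x k - B.repr y k) := by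
  obtain ⟨δ, hδ, hlδ⟩ := exists_nonneg_eq_sum_Iic hl fun i => (hl0 i).le
  choose m c hm hc hmem using fun i =>
    exists_measurable_tailProj_section B i (Metric.isOpen_ball (x := (0 : E)) (ε := r))
  let s : Fin n → E → E := fun i x => tailProj B i x + c i (m i (tailProj B i x))
  refine ⟨fun x => ∑ i, δ i • s i x, fun x i => m i (tailProj B i x),
    fun t => ∑ i, δ i • c i (t i), fun x => ?_, measurable_pi_lambda _ fun i => (hm i).comp
      (tailProj B i).continuous_of_finiteDimensional.measurable, fun x hx y hy k hxy => ?_⟩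
  · simp only [s, smul_add, Finset.sum_add_distrib, diagonalMap_eq_sum_smul_tailProj B hlδ]
  have hs_eq : ∀ i, i ∉ Finset.Iic k → s i x = s i y := fun i hi => by
    have hki : k < i := by simpa using hi
    simp only [s, tailProj_congr B fun j hij => hxy j (hki.trans_le hij)]
  have hs_norm : ∀ i, ‖s i x - s i y‖ < 2 * r := fun i => by
    have hx' := mem_ball_zero_iff.1 (hmem i x hx)
    have hy' := mem_ball_zero_iff.1 (hmem i y hy)
    exact (norm_sub_le _ _).trans_lt (by linarith)
  have hsub : ∑ i, δ i • s i x - ∑ i, δ i • s i y =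
      ∑ i ∈ Finset.Iic k, δ i • (s i x - s i y) := by
    rw [← Finset.sum_sub_distrib]
    simp only [← smul_sub]
    exact (Finset.sum_subset (Finset.subset_univ _) fun i _ hi => by simp [hs_eq i hi]).symm
  rw [hsub]
  constructor
  · exact hlδ k ▸ norm_sum_smul_lt (fun i _ => hδ i) (hlδ k ▸ hl0 k) fun i _ => hs_norm i
  · rw [map_sum, Finsupp.finsetSum_apply, hlδ, Finset.sum_mul]
    refine Finset.sum_congr rfl fun i hi => ?_
    have hik := Finset.mem_Iic.1 hi
    simp [s, repr_tailProj, hc _ _ _ hik, hik]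

theorem exists_ne_and_forall_gt_eq {ι α : Type*} [Finite ι] [LinearOrder ι] {f g : ι → α}
    (h : f ≠ g) : ∃ k, f k ≠ g k ∧ ∀ j > k, f j = g j := by
  obtain ⟨k, hk⟩ := (Set.toFinite {k | f k ≠ g k}).exists_maximal (Function.ne_iff.1 h)
  exact ⟨k, hk.prop, fun j hj => not_not.1 (hk.not_prop_of_gt hj)⟩

theorem prod_mul_measure_ball_le_covolume (μ : Measure E) [μ.IsAddHaarMeasure] {Λ : Submodule ℤ E}
    [DiscreteTopology Λ] [IsZLattice ℝ Λ] {n : ℕ} (B : Basis (Fin n) ℝ E) {l : Fin n → ℝ}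
    (hl : Monotone l) (hl0 : ∀ i, 0 < l i)
    (hmin : ∀ z ∈ Λ, ∀ k, ‖z‖ < l k → B.repr z k = 0) :
    (∏ i, l i) * μ.real (Metric.ball 0 (1 / 2)) ≤ ZLattice.covolume Λ μ := by
  obtain ⟨F, m, c, hF, hm, hFl⟩ := exists_stretch B hl hl0 (r := 1 / 2)
  set Q : Set E := Metric.ball 0 (1 / 2)
  have hpack : ∀ x ∈ Q, ∀ y ∈ Q, F x - F y ∈ Λ → x = y := by
    intro x hx y hy hxy
    by_contra hne
    obtain ⟨k, hk, hmax⟩ := exists_ne_and_forall_gt_eq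
      (mt (fun h => B.ext_elem (congrFun h)) hne : ⇑(B.repr x) ≠ ⇑(B.repr y))
    obtain ⟨hlt, hrepr⟩ := hFl x hx y hy k hmax
    rw [hmin _ hxy k (by simpa using hlt), zero_eq_mul, sub_eq_zero] at hrepr
    exact hrepr.elim (hl0 k).ne' hk
  obtain rfl : F = fun x => diagonalMap B l x + c (m x) := funext hF
  have hinj : Set.InjOn (fun x => diagonalMap B l x + c (m x)) Q :=
    fun x hx y hy hxy => hpack x hx y hy (by simp [hxy])
  have hmeas : Measurable fun x => diagonalMap B l x + c (m x) :=
    (diagonalMap B l).continuous_of_finiteDimensional.measurable.add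
      ((measurable_of_countable c).comp hm)
  have hle := measure_le_covolume_of_forall_sub_mem μ (Λ := Λ)
    (measurableSet_ball.image_of_measurable_injOn hmeas hinj).nullMeasurableSet (by
      rintro _ ⟨x, hx, rfl⟩ _ ⟨y, hy, rfl⟩ hxy
      rw [hpack x hx y hy hxy])
  rw [measure_image_linearMap_add μ _ hm c measurableSet_ball hinj, det_diagonalMap,
    abs_of_pos (Finset.prod_pos fun i _ => hl0 i)] at hle
  have hreal := ENNReal.toReal_mono ENNReal.ofReal_ne_top hle
  rwa [ENNReal.toReal_mul, ENNReal.toReal_ofReal (Finset.prod_nonneg fun i _ => (hl0 i).le),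
    ENNReal.toReal_ofReal (ZLattice.covolume_pos Λ μ).le] at hreal

end Minkowski

section MinimalSystems

theorem exists_norm_le_of_notMem {E : Type*} [NormedAddCommGroup E] [ProperSpace E]
    {Λ : Submodule ℤ E} [DiscreteTopology Λ] {s : Set E} (h : ∃ x ∈ Λ, x ∉ s) :
    ∃ x ∈ Λ, x ∉ s ∧ ∀ z ∈ Λ, z ∉ s → ‖x‖ ≤ ‖z‖ := by
  obtain ⟨y, hy, hys⟩ := h
  have : DiscreteTopology Λ.toAddSubgroup := inferInstanceAs (DiscreteTopology Λ)
  have hclosed : IsClosed (Λ : Set E) :=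
    AddSubgroup.isClosed_of_discrete (H := Λ.toAddSubgroup)
  have hfin : ((Metric.closedBall 0 ‖y‖ ∩ Λ) \ s : Set E).Finite :=
    (Metric.finite_isBounded_inter_isClosed (s := (Λ : Set E)) DiscreteTopology.isDiscrete
      Metric.isBounded_closedBall hclosed).subset Set.sdiff_subset
  obtain ⟨x, ⟨⟨hxy, hx⟩, hxs⟩, hmin⟩ := hfin.exists_minimalFor norm _ ⟨y, ⟨by simp, hy⟩, hys⟩
  refine ⟨x, hx, hxs, fun z hz hzs => (le_total ‖x‖ ‖z‖).elim id fun hzx => hmin ?_ hzx⟩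
  exact ⟨⟨mem_closedBall_zero_iff.2 (hzx.trans (mem_closedBall_zero_iff.1 hxy)), hz⟩, hzs⟩

variable {E : Type*} [NormedAddCommGroup E] [NormedSpace ℝ E]

/-- `v` consists of linearly independent vectors of `Λ`, each of which is a shortest vector of `Λ`
outside the span of the preceding ones. The norms of these vectors are the successive minima of the
closed unit ball with respect to `Λ`. -/
structure IsMinimalSystem (Λ : Submodule ℤ E) {n : ℕ} (v : Fin n → E) : Prop where
  linearIndependent : LinearIndependent ℝ v
  mem : ∀ i, v i ∈ Λ
  norm_le : ∀ k, ∀ z ∈ Λ, z ∉ Submodule.span ℝ (v '' Set.Iio k) → ‖v k‖ ≤ ‖z‖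

namespace IsMinimalSystem

variable {Λ : Submodule ℤ E} {n : ℕ} {v : Fin n → E}

theorem snoc (hv : IsMinimalSystem Λ v) {x : E} (hx : x ∈ Λ)
    (hxv : x ∉ Submodule.span ℝ (Set.range v))
    (hmin : ∀ z ∈ Λ, z ∉ Submodule.span ℝ (Set.range v) → ‖x‖ ≤ ‖z‖) :
    IsMinimalSystem Λ (Fin.snoc v x : Fin (n + 1) → E) := by
  have hlast : (Fin.snoc v x : Fin (n + 1) → E) '' Set.Iio (Fin.last n) = Set.range v := by
    ext y
    simp [Fin.exists_fin_succ', Set.mem_image]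
  have hcast : ∀ k : Fin n, (Fin.snoc v x : Fin (n + 1) → E) '' Set.Iio k.castSucc =
      v '' Set.Iio k := by
    intro k
    ext y
    simp [Fin.exists_fin_succ', Set.mem_image, (Fin.castSucc_lt_last k).not_gt]
  refine ⟨linearIndependent_finSnoc.2 ⟨hv.linearIndependent, hxv⟩,
    Fin.lastCases (by simpa using hx) (by simpa using hv.mem), Fin.lastCases ?_ fun k => ?_⟩
  · simpa [hlast] using hmin
  · simpa [hcast] using hv.norm_le k

theorem exists_of_le_finrank [FiniteDimensional ℝ E] (Λ : Submodule ℤ E) [DiscreteTopology Λ]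
    [IsZLattice ℝ Λ] (hn : n ≤ finrank ℝ E) : ∃ v : Fin n → E, IsMinimalSystem Λ v := by
  induction n with
  | zero => exact ⟨Fin.elim0, linearIndependent_empty_type, fun i => i.elim0, fun k => k.elim0⟩
  | succ n ih =>
    obtain ⟨v, hv⟩ := ih (Nat.le_of_succ_le hn)
    have hΛ : ∃ x ∈ Λ, x ∉ Submodule.span ℝ (Set.range v) := by
      by_contra! h
      have hcard := finrank_span_eq_card hv.linearIndependent
      have htop : Submodule.span ℝ (Set.range v) = ⊤ :=
        top_le_iff.1 (IsZLattice.span_top (K := ℝ) (L := Λ) ▸ Submodule.span_le.2 h)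
      rw [htop, finrank_top, Fintype.card_fin] at hcard
      exact hn.not_gt (hcard ▸ Nat.lt_succ_self n)
    obtain ⟨x, hx, hxv, hmin⟩ := exists_norm_le_of_notMem hΛ
    exact ⟨Fin.snoc v x, hv.snoc hx hxv hmin⟩

theorem norm_pos (hv : IsMinimalSystem Λ v) (k : Fin n) : 0 < ‖v k‖ :=
  norm_pos_iff.2 (hv.linearIndependent.ne_zero k)

theorem monotone_norm (hv : IsMinimalSystem Λ v) : Monotone fun k => ‖v k‖ := fun i j hij =>
  hv.norm_le i _ (hv.mem j) (hv.linearIndependent.notMem_span_image (by simpa using hij))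

theorem exists_norm_le (hv : IsMinimalSystem Λ v) (k : Fin n) {ι : Type*} [Fintype ι] {w : ι → E}
    (hw : LinearIndependent ℝ w) (hwΛ : ∀ i, w i ∈ Λ) (hk : k < Fintype.card ι) :
    ∃ i, ‖v k‖ ≤ ‖w i‖ := by
  classical
  by_contra! h
  have hsub : ∀ i, w i ∈ Submodule.span ℝ (((Finset.Iio k).image v : Finset E) : Set E) := by
    intro i
    by_contra hi
    exact (h i).not_ge (hv.norm_le k _ (hwΛ i) (by simpa using hi))
  have hcard := Submodule.finrank_mono (Submodule.span_le.2 (Set.range_subset_iff.2 hsub))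
  rw [finrank_span_eq_card hw] at hcard
  refine hk.not_ge (hcard.trans ((finrank_span_finset_le_card _).trans ?_))
  exact Finset.card_image_le.trans (Fin.card_Iio k).le

/-- Minkowski's second theorem; the radius `1 / 2` absorbs its usual factor `2 ^ n`. -/
theorem prod_norm_mul_measure_ball_le_covolume [FiniteDimensional ℝ E] [MeasurableSpace E]
    [BorelSpace E] (μ : Measure E) [μ.IsAddHaarMeasure] [DiscreteTopology Λ] [IsZLattice ℝ Λ]
    (hv : IsMinimalSystem Λ v) (hn : n = finrank ℝ E) :
    (∏ i, ‖v i‖) * μ.real (Metric.ball 0 (1 / 2)) ≤ ZLattice.covolume Λ μ := by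
  let B := basisOfLinearIndependentOfCardEqFinrank' v hv.linearIndependent (by simpa using hn)
  have hB : ∀ i, B i = v i := fun i => by simp [B]
  refine prod_mul_measure_ball_le_covolume μ B hv.monotone_norm hv.norm_pos fun z hz k hzk => ?_
  have hspan : Submodule.span ℝ (v '' Set.Iio k) ≤ LinearMap.ker (B.coord k) := by
    rw [Submodule.span_le]
    rintro _ ⟨i, hi, rfl⟩
    rw [SetLike.mem_coe, LinearMap.mem_ker, ← hB, Basis.coord_apply, B.repr_self,
      Finsupp.single_eq_of_ne (ne_of_gt hi)]
  exact hspan (by_contra fun h => hzk.not_ge (hv.norm_le k z hz h))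

end IsMinimalSystem

end MinimalSystems

section SuccessiveMinima

variable {d : ℕ} {Λ : Submodule ℤ (Fin d → ℝ)}

theorem IsMinimalSystem.succMin_closedBall {n : ℕ} {v : Fin n → Fin d → ℝ}
    (hv : IsMinimalSystem Λ v) (k : Fin n) : succMin (Metric.closedBall 0 1) Λ (k + 1) = ‖v k‖ := by
  refine IsLeast.csInf_eq
    ⟨⟨hv.norm_pos k, fun i => v (Fin.castLE k.2 i), ?_, fun i => ⟨hv.mem _, ?_⟩⟩, ?_⟩
  · exact hv.linearIndependent.comp _ (Fin.castLE_injective k.2)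
  · rw [smul_unitClosedBall_of_nonneg (norm_nonneg _), mem_closedBall_zero_iff]
    exact hv.monotone_norm (Fin.le_def.2 (Nat.lt_succ_iff.1 i.2))
  · rintro r ⟨hr, w, hw, hwr⟩
    obtain ⟨i, hi⟩ := hv.exists_norm_le k hw (fun i => (hwr i).1) (by simp)
    have hwi := (hwr i).2
    rw [smul_unitClosedBall_of_nonneg hr.le, mem_closedBall_zero_iff] at hwi
    exact hi.trans hwi

theorem box_zero : box (0 : Fin d → ℝ) = Metric.closedBall 0 1 := by
  simp [box]

theorem IsMinimalSystem.L_zero {n : ℕ} {v : Fin n → Fin d → ℝ} (hv : IsMinimalSystem Λ v)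
    (k : Fin n) : L (k + 1) 0 Λ = Real.log ‖v k‖ := by
  rw [L, box_zero, hv.succMin_closedBall]

end SuccessiveMinima

section Scaling

theorem covolume_comap_eq_inv_abs_det_mul {E : Type*} [NormedAddCommGroup E] [NormedSpace ℝ E]
    [FiniteDimensional ℝ E] [MeasurableSpace E] [BorelSpace E] (μ : Measure E)
    [μ.IsAddHaarMeasure] (Λ : Submodule ℤ E) [DiscreteTopology Λ] [IsZLattice ℝ Λ] (e : E ≃L[ℝ] E) :
    ZLattice.covolume (ZLattice.comap ℝ Λ e.toLinearMap) μ =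
      |LinearMap.det e.toLinearMap|⁻¹ * ZLattice.covolume Λ μ := by
  classical
  let b := Free.chooseBasis ℤ Λ
  let b₀ := b.ofZLatticeBasis ℝ Λ
  have hb : ((↑) : Λ → E) ∘ b = e.toLinearMap ∘
      ((↑) ∘ b.ofZLatticeComap ℝ Λ e.toLinearEquiv : _ → E) := by
    ext i
    simp
  have hdet : |LinearMap.det e.toLinearMap| ≠ 0 := abs_ne_zero.2 e.toLinearEquiv.isUnit_det'.ne_zero
  rw [ZLattice.covolume_eq_det_mul_measureReal Λ μ b b₀, hb, b₀.det_comp,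
    ZLattice.covolume_eq_det_mul_measureReal _ μ (b.ofZLatticeComap ℝ Λ e.toLinearEquiv) b₀,
    abs_mul, mul_assoc, inv_mul_cancel_left₀ hdet]

section ExpDiagonal

variable {ι : Type*}

/-- The linear automorphism `diag (exp τ₁, …, exp τ_d)` of `ℝ^d`, which maps the unit ball `B` of
the sup norm onto `B_τ`. -/
noncomputable def expDiagonal (τ : ι → ℝ) : (ι → ℝ) ≃L[ℝ] (ι → ℝ) :=
  .piCongrRight fun i => .smulLeft (Units.mk0 (Real.exp (τ i)) (Real.exp_ne_zero _))

theorem expDiagonal_apply (τ x : ι → ℝ) (i : ι) : expDiagonal τ x i = Real.exp (τ i) * x i :=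
  rfl

variable [Fintype ι]

theorem det_expDiagonal (τ : ι → ℝ) :
    LinearMap.det (expDiagonal τ).toLinearMap = Real.exp (∑ i, τ i) := by
  classical
  have h : (expDiagonal τ).toLinearMap =
      diagonalMap (Pi.basisFun ℝ ι) fun i => Real.exp (τ i) :=
    LinearMap.ext fun x => (Pi.basisFun ℝ ι).ext_elem fun i => by
      rw [repr_diagonalMap]
      rfl
  rw [h, det_diagonalMap, Real.exp_sum]

theorem log_covolume_comap_expDiagonal (Λ : Submodule ℤ (ι → ℝ)) [DiscreteTopology Λ]
    [IsZLattice ℝ Λ] (τ : ι → ℝ) :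
    Real.log (ZLattice.covolume (ZLattice.comap ℝ Λ (expDiagonal τ).toLinearMap)) =
      Real.log (ZLattice.covolume Λ) - ∑ i, τ i := by
  rw [covolume_comap_eq_inv_abs_det_mul, det_expDiagonal, abs_of_pos (Real.exp_pos _),
    Real.log_mul (by positivity) (ZLattice.covolume_ne_zero Λ _), Real.log_inv, Real.log_exp]
  ring

end ExpDiagonal

variable {d : ℕ}

theorem succMin_image (e : (Fin d → ℝ) ≃ₗ[ℝ] (Fin d → ℝ)) (B : Set (Fin d → ℝ))
    (Λ : Submodule ℤ (Fin d → ℝ)) (k : ℕ) :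
    succMin (e '' B) Λ k = succMin B (ZLattice.comap ℝ Λ e.toLinearMap) k := by
  refine congrArg sInf (Set.ext fun r => and_congr_right fun _ => ?_)
  rw [e.surjective.comp_left.exists]
  refine exists_congr fun v => and_congr (e.toLinearMap.linearIndependent_iff e.ker) ?_
  refine forall_congr' fun i => and_congr Iff.rfl ?_
  rw [← image_smul_set, Function.comp_apply, e.injective.mem_set_image]

theorem box_eq_image_expDiagonal (τ : Fin d → ℝ) :
    box τ = expDiagonal τ '' Metric.closedBall 0 1 :=
  Set.image_congr fun _ _ => funext fun i => Matrix.mulVec_diagonal _ _ i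

theorem L_eq_L_zero (k : ℕ) (τ : Fin d → ℝ) (Λ : Submodule ℤ (Fin d → ℝ)) :
    L k τ Λ = L k 0 (ZLattice.comap ℝ Λ (expDiagonal τ).toLinearMap) := by
  rw [L, L, box_zero, box_eq_image_expDiagonal]
  exact congrArg Real.log (succMin_image (expDiagonal τ).toLinearEquiv _ Λ k)

theorem S_eq_S_zero (k : ℕ) (τ : Fin d → ℝ) (Λ : Submodule ℤ (Fin d → ℝ)) :
    S k τ Λ = S k 0 (ZLattice.comap ℝ Λ (expDiagonal τ).toLinearMap) :=
  Finset.sum_congr rfl fun j _ => L_eq_L_zero j τ Λ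

theorem dualLattice_comap_expDiagonal (τ : Fin d → ℝ) (Λ : Submodule ℤ (Fin d → ℝ)) :
    dualLattice (ZLattice.comap ℝ Λ (expDiagonal τ).toLinearMap) =
      ZLattice.comap ℝ (dualLattice Λ) (expDiagonal (-τ)).toLinearMap := by
  ext y
  have hinv : ∀ z, expDiagonal τ (expDiagonal (-τ) z) = z := fun z => funext fun i => by
    simp [expDiagonal_apply, ← mul_assoc, ← Real.exp_add]
  have hadj : ∀ z, ∑ i, y i * expDiagonal (-τ) z i = ∑ i, expDiagonal (-τ) y i * z i := fun z =>
    Finset.sum_congr rfl fun i _ => by simp only [expDiagonal_apply]; ring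
  change _ ↔ expDiagonal (-τ) y ∈ dualLattice Λ
  rw [mem_dualLattice, mem_dualLattice, (expDiagonal (-τ)).surjective.forall]
  refine forall_congr' fun z => imp_congr ?_ (by rw [hadj])
  change expDiagonal τ (expDiagonal (-τ) z) ∈ Λ ↔ z ∈ Λ
  rw [hinv]

end Scaling

section Determinants

variable {ι : Type*} [Fintype ι]

theorem exists_span_range_eq (Λ : Submodule ℤ (ι → ℝ)) [DiscreteTopology Λ] [IsZLattice ℝ Λ] :
    ∃ B : Basis ι ℝ (ι → ℝ), Submodule.span ℤ (Set.range B) = Λ :=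
  ⟨(IsZLattice.basis Λ).ofZLatticeBasis ℝ Λ, Basis.ofZLatticeBasis_span ℝ Λ _⟩

theorem covolume_span_range [DecidableEq ι] (B : Basis ι ℝ (ι → ℝ)) :
    ZLattice.covolume (Submodule.span ℤ (Set.range B)) = |(Matrix.of B).det| := by
  rw [ZLattice.covolume_eq_det _ (B.restrictScalars ℤ)]
  congr 3
  ext i
  simp

theorem norm_det_le_factorial_mul_prod_norm [DecidableEq ι] {R : Type*} [NormedCommRing R]
    [NormOneClass R] (M : Matrix ι ι R) :
    ‖M.det‖ ≤ (Fintype.card ι).factorial * ∏ i, ‖M i‖ := by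
  have hσ : ∀ σ ∈ Finset.univ, ‖Equiv.Perm.sign σ • ∏ i, M.transpose (σ i) i‖ ≤ ∏ i, ‖M i‖ := by
    intro σ _
    rw [norm_units_zsmul]
    exact (Finset.norm_prod_le _ _).trans
      (Finset.prod_le_prod (fun i _ => norm_nonneg _) fun i _ => norm_le_pi_norm (M i) (σ i))
  calc ‖M.det‖ = ‖∑ σ : Equiv.Perm ι, Equiv.Perm.sign σ • ∏ i, M.transpose (σ i) i‖ := by
        rw [← M.det_transpose, Matrix.det_apply]
    _ ≤ ∑ _σ : Equiv.Perm ι, ∏ i, ‖M i‖ := norm_sum_le_of_le _ hσ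
    _ = (Fintype.card ι).factorial * ∏ i, ‖M i‖ := by
        rw [Finset.sum_const, Finset.card_univ, Fintype.card_perm, nsmul_eq_mul]

theorem norm_transpose_adjugate_le [DecidableEq ι] {R : Type*} [NormedCommRing R]
    [NormOneClass R] (M : Matrix ι ι R) (j : ι) :
    ‖M.adjugate.transpose j‖ ≤
      (Fintype.card ι).factorial * ∏ i ∈ Finset.univ \ {j}, ‖M i‖ := by
  refine (pi_norm_le_iff_of_nonneg (by positivity)).2 fun i => ?_
  have hrow : ∀ l, ‖M.updateRow j (Pi.single i 1) l‖ = Function.update (fun l => ‖M l‖) j 1 l := by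
    intro l
    rcases eq_or_ne l j with rfl | hl
    · simp [Pi.norm_single]
    · rw [Matrix.updateRow_ne hl, Function.update_of_ne hl]
  rw [Matrix.transpose_apply, Matrix.adjugate_apply]
  refine (norm_det_le_factorial_mul_prod_norm _).trans_eq ?_
  rw [Finset.prod_congr rfl fun l _ => hrow l, Finset.prod_update_of_mem (Finset.mem_univ j),
    one_mul]

variable {Λ : Submodule ℤ (ι → ℝ)} [DiscreteTopology Λ] [IsZLattice ℝ Λ]

theorem exists_det_eq_intCast_mul_covolume [DecidableEq ι] {x : ι → ι → ℝ} (hx : ∀ i, x i ∈ Λ) :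
    ∃ n : ℤ, (Matrix.of x).det = n * ZLattice.covolume Λ := by
  obtain ⟨B, rfl⟩ := exists_span_range_eq Λ
  choose A hA using fun i => (B.mem_span_iff_repr_mem ℤ (x i)).1 (hx i)
  have hmul : Matrix.of x = (Matrix.of A).map (Int.castRingHom ℝ) * Matrix.of B := by
    ext i j
    rw [Matrix.mul_apply, Matrix.of_apply, ← B.sum_repr (x i), Finset.sum_apply]
    refine Finset.sum_congr rfl fun l _ => ?_
    rw [← hA]
    simp
  have hdet : (Matrix.of x).det = (Matrix.of A).det * (Matrix.of B).det := by
    rw [hmul, Matrix.det_mul, ← RingHom.mapMatrix_apply, ← RingHom.map_det, eq_intCast]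
  rw [hdet, covolume_span_range]
  rcases abs_choice (Matrix.of B).det with h | h
  · exact ⟨(Matrix.of A).det, by rw [h]⟩
  · exact ⟨-(Matrix.of A).det, by rw [h, Int.cast_neg, neg_mul_neg]⟩

theorem covolume_le_factorial_mul_prod_norm {v : ι → ι → ℝ} (hv : LinearIndependent ℝ v)
    (hvΛ : ∀ i, v i ∈ Λ) :
    ZLattice.covolume Λ ≤ (Fintype.card ι).factorial * ∏ i, ‖v i‖ := by
  classical
  obtain ⟨n, hn⟩ := exists_det_eq_intCast_mul_covolume hvΛ
  have hdet : (Matrix.of v).det ≠ 0 := ((Matrix.isUnit_iff_isUnit_det _).1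
    (Matrix.linearIndependent_rows_iff_isUnit.1 hv)).ne_zero
  have hn0 : n ≠ 0 := by
    rintro rfl
    exact hdet (by simpa using hn)
  have hn1 : (1 : ℝ) ≤ |(n : ℝ)| := by exact_mod_cast Int.one_le_abs hn0
  have hpos := ZLattice.covolume_pos Λ volume
  calc ZLattice.covolume Λ ≤ |(n : ℝ)| * ZLattice.covolume Λ := le_mul_of_one_le_left hpos.le hn1
    _ = ‖(Matrix.of v).det‖ := by rw [hn, Real.norm_eq_abs, abs_mul, abs_of_pos hpos]
    _ ≤ (Fintype.card ι).factorial * ∏ i, ‖v i‖ := norm_det_le_factorial_mul_prod_norm _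

end Determinants

section DualLattice

variable {d : ℕ}

theorem stdForm_isSymm : (stdForm d).IsSymm :=
  ⟨dotProduct_comm⟩

theorem stdForm_nondegenerate : (stdForm d).Nondegenerate :=
  stdForm_isSymm.isRefl.nondegenerate_iff_separatingLeft.2 fun x hx =>
    dotProduct_self_eq_zero.1 (hx x)

theorem dualLattice_span_range (B : Basis (Fin d) ℝ (Fin d → ℝ)) :
    dualLattice (Submodule.span ℤ (Set.range B)) =
      Submodule.span ℤ (Set.range ((stdForm d).dualBasis stdForm_nondegenerate B)) :=
  LinearMap.BilinForm.dualSubmodule_span_of_basis _ stdForm_nondegenerate B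

variable (Λ : Submodule ℤ (Fin d → ℝ)) [DiscreteTopology Λ] [IsZLattice ℝ Λ]

instance : DiscreteTopology (dualLattice Λ) := by
  obtain ⟨B, rfl⟩ := exists_span_range_eq Λ
  rw [dualLattice_span_range]
  infer_instance

instance : IsZLattice ℝ (dualLattice Λ) := by
  obtain ⟨B, rfl⟩ := exists_span_range_eq Λ
  simp only [dualLattice_span_range]
  infer_instance

theorem covolume_dualLattice :
    ZLattice.covolume (dualLattice Λ) = (ZLattice.covolume Λ)⁻¹ := by
  obtain ⟨B, rfl⟩ := exists_span_range_eq Λ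
  let B' := (stdForm d).dualBasis stdForm_nondegenerate B
  have hmul : Matrix.of B' * (Matrix.of B).transpose = 1 := by
    ext i j
    have h := LinearMap.BilinForm.apply_dualBasis_left (B := stdForm d) stdForm_nondegenerate B i j
    rw [Matrix.one_apply]
    simp only [eq_comm (a := j)] at h
    exact h
  rw [dualLattice_span_range, covolume_span_range, covolume_span_range]
  refine eq_inv_of_mul_eq_one_left ?_
  rw [← abs_mul, ← (Matrix.of B).det_transpose, ← Matrix.det_mul, hmul, Matrix.det_one, abs_one]

end DualLattice

section Duality

theorem exists_bilinForm_apply_ne_zero {K V ι κ : Type*} [Field K] [AddCommGroup V] [Module K V]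
    [FiniteDimensional K V] [Fintype ι] [Fintype κ] {B : LinearMap.BilinForm K V}
    (hB : B.Nondegenerate) {v : ι → V} {w : κ → V} (hv : LinearIndependent K v)
    (hw : LinearIndependent K w) (h : finrank K V < Fintype.card ι + Fintype.card κ) :
    ∃ i j, B (v i) (w j) ≠ 0 := by
  by_contra! hzero
  have hle : Submodule.span K (Set.range w) ≤ B.orthogonal (Submodule.span K (Set.range v)) := by
    rw [Submodule.span_le]
    rintro _ ⟨j, rfl⟩ x hx
    have hker : Submodule.span K (Set.range v) ≤ LinearMap.ker (B.flip (w j)) := by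
      rw [Submodule.span_le]
      rintro _ ⟨i, rfl⟩
      exact hzero i j
    exact hker hx
  have hrank := Submodule.finrank_mono hle
  rw [LinearMap.BilinForm.finrank_orthogonal hB, finrank_span_eq_card hv,
    finrank_span_eq_card hw] at hrank
  have := hv.fintype_card_le_finrank
  omega

theorem abs_sum_mul_le_card_mul_norm_mul_norm {ι : Type*} [Fintype ι] (x y : ι → ℝ) :
    |∑ i, x i * y i| ≤ Fintype.card ι * (‖x‖ * ‖y‖) := by
  have hterm : ∀ i ∈ Finset.univ, |x i * y i| ≤ ‖x‖ * ‖y‖ := fun i _ => by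
    rw [abs_mul]
    exact mul_le_mul (norm_le_pi_norm x i) (norm_le_pi_norm y i) (abs_nonneg _) (norm_nonneg _)
  refine (Finset.abs_sum_le_sum_abs _ _).trans ((Finset.sum_le_card_nsmul _ _ _ hterm).trans_eq ?_)
  rw [Finset.card_univ, nsmul_eq_mul]

variable {d : ℕ} {Λ : Submodule ℤ (Fin d → ℝ)}

theorem one_le_mul_norm_mul_norm_of_mem_dualLattice {x y : Fin d → ℝ} (hy : y ∈ dualLattice Λ)
    (hx : x ∈ Λ) (hxy : stdForm d y x ≠ 0) : 1 ≤ d * (‖y‖ * ‖x‖) := by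
  obtain ⟨n, hn⟩ := (mem_dualLattice Λ y).1 hy x hx
  have hn0 : (n : ℝ) ≠ 0 := hn ▸ hxy
  calc (1 : ℝ) ≤ |(n : ℝ)| := by exact_mod_cast Int.one_le_abs (by exact_mod_cast hn0)
    _ = |∑ i, y i * x i| := by rw [hn]
    _ ≤ d * (‖y‖ * ‖x‖) := by simpa using abs_sum_mul_le_card_mul_norm_mul_norm y x

theorem IsMinimalSystem.one_le_mul_norm_mul_norm_rev {v w : Fin d → Fin d → ℝ}
    (hv : IsMinimalSystem Λ v) (hw : IsMinimalSystem (dualLattice Λ) w) (k : Fin d) :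
    1 ≤ d * (‖v k‖ * ‖w k.rev‖) := by
  obtain ⟨⟨j, hj⟩, ⟨i, hi⟩, hij⟩ := exists_bilinForm_apply_ne_zero stdForm_nondegenerate
    (hw.linearIndependent.comp _ (Subtype.val_injective (p := (· ∈ Finset.Iic k.rev))))
    (hv.linearIndependent.comp _ (Subtype.val_injective (p := (· ∈ Finset.Iic k))))
    (by simp only [Fintype.card_coe, Fin.card_Iic, Fin.val_rev, finrank_fin_fun]; omega)
  calc (1 : ℝ) ≤ d * (‖w j‖ * ‖v i‖) :=
        one_le_mul_norm_mul_norm_of_mem_dualLattice (hw.mem j) (hv.mem i) hij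
    _ ≤ d * (‖w k.rev‖ * ‖v k‖) := by
        gcongr
        exacts [hw.monotone_norm (Finset.mem_Iic.1 hj), hv.monotone_norm (Finset.mem_Iic.1 hi)]
    _ = d * (‖v k‖ * ‖w k.rev‖) := by rw [mul_comm ‖v k‖]

variable [DiscreteTopology Λ] [IsZLattice ℝ Λ]

theorem inv_covolume_smul_transpose_adjugate_mem_dualLattice {v : Fin d → Fin d → ℝ}
    (hv : ∀ i, v i ∈ Λ) (j : Fin d) :
    (ZLattice.covolume Λ)⁻¹ • (Matrix.of v).adjugate.transpose j ∈ dualLattice Λ := by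
  refine (mem_dualLattice Λ _).2 fun x hx => ?_
  obtain ⟨n, hn⟩ := exists_det_eq_intCast_mul_covolume (x := Function.update v j x) fun i => by
    rcases eq_or_ne i j with rfl | hij
    · simpa using hx
    · simpa [hij] using hv i
  have hcramer : ∑ i, (Matrix.of v).adjugate.transpose j i * x i =
      (Matrix.of (Function.update v j x)).det := by
    have h := congrFun (Matrix.cramer_eq_adjugate_mulVec (Matrix.of v).transpose x) j
    rw [Matrix.cramer_transpose_apply, ← Matrix.adjugate_transpose] at h
    exact h.symm
  refine ⟨n, ?_⟩
  simp only [Pi.smul_apply, smul_eq_mul, mul_assoc, ← Finset.mul_sum]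
  rw [hcramer, hn, mul_comm, mul_inv_cancel_right₀ (ZLattice.covolume_ne_zero Λ volume)]

theorem linearIndependent_transpose_adjugate {ι K : Type*} [Fintype ι] [DecidableEq ι] [Field K]
    {v : ι → ι → K} (hv : LinearIndependent K v) :
    LinearIndependent K (Matrix.of v).adjugate.transpose := by
  have hdet : IsUnit (Matrix.of v).det := (Matrix.isUnit_iff_isUnit_det _).1
    (Matrix.linearIndependent_rows_iff_isUnit.1 hv)
  refine Matrix.linearIndependent_rows_iff_isUnit.2 ((Matrix.isUnit_transpose _).2 ?_)
  rw [Matrix.isUnit_iff_isUnit_det, Matrix.det_adjugate]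
  exact hdet.pow _

theorem IsMinimalSystem.prod_norm_le_covolume {v : Fin d → Fin d → ℝ} (hv : IsMinimalSystem Λ v) :
    ∏ i, ‖v i‖ ≤ ZLattice.covolume Λ := by
  have h := hv.prod_norm_mul_measure_ball_le_covolume volume (by simp)
  rwa [measureReal_def, Real.volume_pi_ball _ one_half_pos, mul_one_div_cancel two_ne_zero, one_pow,
    ENNReal.ofReal_one, ENNReal.toReal_one, mul_one] at h

theorem IsMinimalSystem.norm_mul_norm_rev_le_factorial {v w : Fin d → Fin d → ℝ}
    (hv : IsMinimalSystem Λ v) (hw : IsMinimalSystem (dualLattice Λ) w) (k : Fin d) :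
    ‖v k‖ * ‖w k.rev‖ ≤ d.factorial := by
  have hpos := ZLattice.covolume_pos Λ volume
  let c : Fin d → Fin d → ℝ := fun j =>
    (ZLattice.covolume Λ)⁻¹ • (Matrix.of v).adjugate.transpose j
  have hc : LinearIndependent ℝ c := (linearIndependent_transpose_adjugate
    hv.linearIndependent).units_smul fun _ => Units.mk0 _ (inv_ne_zero hpos.ne')
  obtain ⟨⟨j, hkj⟩, hwj⟩ := hw.exists_norm_le k.rev
    (hc.comp _ (Subtype.val_injective (p := (· ∈ Finset.Ici k))))
    (fun j => inv_covolume_smul_transpose_adjugate_mem_dualLattice hv.mem j)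
    (by rw [Fintype.card_coe, Fin.card_Ici, Fin.val_rev]; omega)
  have hcj : ‖(Matrix.of v).adjugate.transpose j‖ ≤
      d.factorial * ∏ i ∈ Finset.univ \ {j}, ‖v i‖ := by
    have h := norm_transpose_adjugate_le (Matrix.of v) j
    rwa [Fintype.card_fin] at h
  calc ‖v k‖ * ‖w k.rev‖
      ≤ ‖v j‖ * ‖c j‖ := mul_le_mul (hv.monotone_norm (Finset.mem_Ici.1 hkj)) hwj (norm_nonneg _)
        (norm_nonneg _)
    _ = ‖v j‖ * ((ZLattice.covolume Λ)⁻¹ * ‖(Matrix.of v).adjugate.transpose j‖) := by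
        rw [norm_smul, norm_inv, Real.norm_of_nonneg hpos.le]
    _ ≤ ‖v j‖ * ((ZLattice.covolume Λ)⁻¹ * (d.factorial * ∏ i ∈ Finset.univ \ {j}, ‖v i‖)) := by
        gcongr
    _ = d.factorial * ((∏ i, ‖v i‖) / ZLattice.covolume Λ) := by
        rw [← Finset.prod_sdiff (Finset.subset_univ {j}), Finset.prod_singleton]
        ring
    _ ≤ d.factorial := mul_le_of_le_one_right (Nat.cast_nonneg _)
        ((div_le_one hpos).2 hv.prod_norm_le_covolume)

end Duality

section LogarithmicMinima

theorem sum_Icc_reflect_add_sum_Icc {M : Type*} [AddCommMonoid M] (f : ℕ → M) {d k : ℕ}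
    (hk : k ≤ d) :
    ∑ j ∈ Finset.Icc 1 k, f (d + 1 - j) + ∑ j ∈ Finset.Icc 1 (d - k), f j =
      ∑ j ∈ Finset.Icc 1 d, f j := by
  simp only [← Finset.Ico_add_one_right_eq_Icc]
  rw [Finset.sum_Ico_reflect f 1 (by omega), add_comm,
    show d + 1 + 1 - (k + 1) = d - k + 1 by omega,
    Finset.sum_Ico_consecutive f (by omega) (by omega), Nat.add_sub_cancel]

variable {d : ℕ}

theorem IsMinimalSystem.S_zero {Λ : Submodule ℤ (Fin d → ℝ)} {n : ℕ} {v : Fin n → Fin d → ℝ}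
    (hv : IsMinimalSystem Λ v) : S n 0 Λ = Real.log (∏ i, ‖v i‖) := by
  rw [S, ← Finset.Ico_add_one_right_eq_Icc, Finset.sum_Ico_eq_sum_range, Nat.add_sub_cancel,
    Finset.sum_range, Real.log_prod fun i _ => (hv.norm_pos i).ne']
  exact Finset.sum_congr rfl fun i _ => by rw [add_comm, hv.L_zero]

variable (Λ : Submodule ℤ (Fin d → ℝ)) [DiscreteTopology Λ] [IsZLattice ℝ Λ]

theorem L_zero_add_L_zero_dualLattice {k : ℕ} (hk : 1 ≤ k) (hkd : k ≤ d) :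
    -Real.log d ≤ L k 0 Λ + L (d + 1 - k) 0 (dualLattice Λ) ∧
      L k 0 Λ + L (d + 1 - k) 0 (dualLattice Λ) ≤ Real.log d.factorial := by
  obtain ⟨v, hv⟩ := IsMinimalSystem.exists_of_le_finrank Λ (n := d) (by simp)
  obtain ⟨w, hw⟩ := IsMinimalSystem.exists_of_le_finrank (dualLattice Λ) (n := d) (by simp)
  obtain ⟨i, rfl⟩ : ∃ i : Fin d, k = i + 1 := ⟨⟨k - 1, by omega⟩, by simp; omega⟩
  have hrev : d + 1 - (i + 1) = i.rev + 1 := by rw [Fin.val_rev]; omega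
  have hpos := mul_pos (hv.norm_pos i) (hw.norm_pos i.rev)
  rw [hrev, hv.L_zero, hw.L_zero, ← Real.log_mul (hv.norm_pos _).ne' (hw.norm_pos _).ne',
    ← Real.log_inv]
  have hd : (0 : ℝ) < d := by exact_mod_cast i.pos
  refine ⟨Real.log_le_log (inv_pos.2 hd) ?_,
    Real.log_le_log hpos (hv.norm_mul_norm_rev_le_factorial hw i)⟩
  exact (inv_le_iff_one_le_mul₀' hd).2 (hv.one_le_mul_norm_mul_norm_rev hw i)

theorem S_zero_le_log_covolume : S d 0 Λ ≤ Real.log (ZLattice.covolume Λ) := by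
  obtain ⟨v, hv⟩ := IsMinimalSystem.exists_of_le_finrank Λ (n := d) (by simp)
  rw [hv.S_zero]
  exact Real.log_le_log (Finset.prod_pos fun i _ => hv.norm_pos i) hv.prod_norm_le_covolume

theorem log_covolume_le_log_factorial_add_S_zero :
    Real.log (ZLattice.covolume Λ) ≤ Real.log d.factorial + S d 0 Λ := by
  obtain ⟨v, hv⟩ := IsMinimalSystem.exists_of_le_finrank Λ (n := d) (by simp)
  have hprod : 0 < ∏ i, ‖v i‖ := Finset.prod_pos fun i _ => hv.norm_pos i
  rw [hv.S_zero, ← Real.log_mul (by positivity) hprod.ne']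
  refine Real.log_le_log (ZLattice.covolume_pos Λ volume) ?_
  simpa using covolume_le_factorial_mul_prod_norm hv.linearIndependent hv.mem

theorem S_zero_sub_S_zero_dualLattice {k : ℕ} (hk : k ≤ d) :
    -(k * Real.log d) ≤
        S k 0 Λ - S (d - k) 0 (dualLattice Λ) - Real.log (ZLattice.covolume Λ) ∧
      S k 0 Λ - S (d - k) 0 (dualLattice Λ) - Real.log (ZLattice.covolume Λ) ≤
        (k + 1) * Real.log d.factorial := by
  have hpair := fun j (hj : j ∈ Finset.Icc 1 k) =>
    L_zero_add_L_zero_dualLattice Λ (Finset.mem_Icc.1 hj).1 ((Finset.mem_Icc.1 hj).2.trans hk)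
  have hlow := Finset.card_nsmul_le_sum _ _ _ fun j hj => (hpair j hj).1
  have hupp := Finset.sum_le_card_nsmul _ _ _ fun j hj => (hpair j hj).2
  have hreflect := sum_Icc_reflect_add_sum_Icc (fun j => L j 0 (dualLattice Λ)) hk
  have hS_le := S_zero_le_log_covolume (dualLattice Λ)
  have hle_S := log_covolume_le_log_factorial_add_S_zero (dualLattice Λ)
  rw [covolume_dualLattice, Real.log_inv] at hS_le hle_S
  rw [Finset.sum_add_distrib, Nat.card_Icc, nsmul_eq_mul, Nat.add_sub_cancel] at hlow hupp
  simp only [S] at hS_le hle_S ⊢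
  constructor <;> linarith

end LogarithmicMinima

end MultParamGeom

open MultParamGeom in
theorem mainTheorem6_general (d : ℕ) (Λ : Submodule ℤ (Fin d → ℝ)) [DiscreteTopology Λ]
    [IsZLattice ℝ Λ] (τ : Fin d → ℝ) :
    (∀ k : ℕ, 1 ≤ k → k ≤ d →
      -Real.log d ≤ L k τ Λ + L (d + 1 - k) (-τ) (dualLattice Λ) ∧
        L k τ Λ + L (d + 1 - k) (-τ) (dualLattice Λ) ≤ Real.log d.factorial) ∧
    (∀ k : ℕ, k ≤ d →
      -(k * Real.log d) ≤
          S k τ Λ - S (d - k) (-τ) (dualLattice Λ) -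
            (Real.log (ZLattice.covolume Λ) - ∑ i, τ i) ∧
        S k τ Λ - S (d - k) (-τ) (dualLattice Λ) -
            (Real.log (ZLattice.covolume Λ) - ∑ i, τ i) ≤
          (k + 1) * Real.log d.factorial) := by
  simp only [L_eq_L_zero _ τ, L_eq_L_zero _ (-τ), S_eq_S_zero _ τ, S_eq_S_zero _ (-τ),
    ← dualLattice_comap_expDiagonal, ← log_covolume_comap_expDiagonal]
  exact ⟨fun k => L_zero_add_L_zero_dualLattice _, fun k => S_zero_sub_S_zero_dualLattice _⟩

theorem mainTheorem6 (d : ℕ) (Λ : Submodule ℤ (Fin d → ℝ)) [DiscreteTopology Λ] [IsZLattice ℝ Λ]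
    (hΛ : ZLattice.covolume Λ = 1) (τ : Fin d → ℝ) (hτ : ∑ i, τ i = 0) :
    (∀ k : ℕ, 1 ≤ k → k ≤ d →
      -Real.log (d : ℝ) ≤
          MultParamGeom.L k τ Λ
            + MultParamGeom.L (d + 1 - k) (-τ) (MultParamGeom.dualLattice Λ) ∧
        MultParamGeom.L k τ Λ
            + MultParamGeom.L (d + 1 - k) (-τ) (MultParamGeom.dualLattice Λ)
          ≤ Real.log (d.factorial : ℝ)) ∧
    (∀ k : ℕ, 1 ≤ k → k < d →
      -((k : ℝ) * Real.log (d : ℝ)) ≤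
          MultParamGeom.S k τ Λ
            - MultParamGeom.S (d - k) (-τ) (MultParamGeom.dualLattice Λ) ∧
        MultParamGeom.S k τ Λ
            - MultParamGeom.S (d - k) (-τ) (MultParamGeom.dualLattice Λ)
          ≤ ((k : ℝ) + 1) * Real.log (d.factorial : ℝ)) := by
  obtain ⟨hL, hS⟩ := mainTheorem6_general d Λ τ
  exact ⟨hL, fun k _ hk => by simpa [hΛ, hτ] using hS k hk.le⟩
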